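/- Let $\beta\in\{1,2,4\}$ and let $\mathbb F_\beta$ be $\mathbb R$, $\mathbb C$ or the real quaternions $\mathbb H$, respectively. Let $n\ge N$. Let $\mathcal M^\beta_{n\times N}$ be the set of $n\times N$ matrices with entries in $\mathbb F_\beta$, let $(\mathrm dM)$ be Lebesgue measure on it (the product of Lebesgue measures in all real components of all entries), and write $M^\dagger$ for the conjugate transpose. Let $\mathcal P^\beta_{+,N}$ be the set of $N\times N$ Hermitian matrices over $\mathbb F_\beta$ with all eigenvalues non-negative, with Lebesgue measure $(\mathrm dW)$ in the independent real components of the entries. For $W\in\mathcal P^\beta_{+,N}$ let $\det W$ be the product of the $N$ eigenvalues of $W$; for $\beta=4$ this means that in the representation of $W$ as a $2N\times 2N$ complex matrix (each quaternion $z+wj$, $z,w\in\mathbb C$, being replaced by $\begin{bmatrix} z&w\\-\overline w&\overline z\end{bmatrix}$) each eigenvalue, which there occurs twice, is counted once, i.e. $\det W$ is the square root of the determinant of that complex matrix. Put $\sigma_l=2\pi^{l/2}/\Gamma(l/2)$, the surface area of the unit sphere in $\mathbb R^l$. Let $f:\mathcal P^\beta_{+,N}\to\mathbb R$ be Lebesgue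 measurable. Then $M\mapsto f(M^\dagger M)$ is absolutely integrable on $\mathcal M^\beta_{n\times N}$ if and only if $M\mapsto f(M^\dagger M)\,(\det M^\dagger M)^{\beta(n-N)/2}$ is absolutely integrable on $\mathcal M^\beta_{N\times N}$, and in that case $$\int_{\mathcal M^\beta_{n\times N}} f(M^\dagger M)\,(\mathrm dM)=\prod_{i=1}^N\frac{\sigma_{\beta(n-i+1)}}{\sigma_{\beta(N-i+1)}}\int_{\mathcal M^\beta_{N\times N}} f(M^\dagger M)\,(\det M^\dagger M)^{\beta(n-N)/2}\,(\mathrm dM).$$ -/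

import Mathlib

open MeasureTheory
open scoped Matrix Quaternion

noncomputable section

/-- The Borel σ-algebra on the real quaternions. The measure `volume` on `ℍ[ℝ]` is then the one
Mathlib attaches to a finite-dimensional real inner product space: Lebesgue measure in the four
real components `re, imI, imJ, imK` (which form orthonormal coordinates). -/
instance quaternionMeasurableSpace : MeasurableSpace ℍ[ℝ] := borel ℍ[ℝ]

instance quaternionBorelSpace : BorelSpace ℍ[ℝ] := ⟨rfl⟩

/-- Matrices carry the product σ-algebra of their entries. -/
instance matrixMeasurableSpace {m k F : Type} [MeasurableSpace F] :
    MeasurableSpace (Matrix m k F) :=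
  inferInstanceAs (MeasurableSpace (m → k → F))

/-- The measure `(dM)` on `n × N` matrices with entries in `F`: the product over all entries of
Lebesgue measure on `F` (that is, Lebesgue measure in all real components of all entries). -/
def matrixLebesgue (F : Type) [MeasureSpace F] (n N : ℕ) :
    Measure (Matrix (Fin n) (Fin N) F) :=
  (Measure.pi fun _ : Fin n => Measure.pi fun _ : Fin N => (volume : Measure F) :
    Measure (Fin n → Fin N → F))

/-- The Hermitian matrix with real diagonal `c.1` and with entries `c.2` strictly above the
diagonal. -/
def hermitianOfCoords {F : Type} [Ring F] [StarRing F] [Algebra ℝ F] {N : ℕ}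
    (c : (Fin N → ℝ) × ({p : Fin N × Fin N // p.1 < p.2} → F)) : Matrix (Fin N) (Fin N) F :=
  Matrix.of fun i j =>
    if h : i < j then c.2 ⟨(i, j), h⟩
    else if h' : j < i then star (c.2 ⟨(j, i), h'⟩)
    else algebraMap ℝ F (c.1 i)

/-- The set of Hermitian `N × N` matrices over `F` all of whose eigenvalues are non-negative
(the eigenvalues of a Hermitian matrix over `ℝ`, `ℂ` or `ℍ[ℝ]` are real). -/
def posHermitian (F : Type) [Ring F] [StarRing F] [Algebra ℝ F] (N : ℕ) :
    Set (Matrix (Fin N) (Fin N) F) :=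
  {W | W.IsHermitian ∧ ∀ (a : ℝ) (v : Fin N → F), v ≠ 0 → W *ᵥ v = a • v → 0 ≤ a}

/-- The measure `(dW)` on the set `posHermitian F N`: Lebesgue measure in the independent real
components of the entries of a Hermitian matrix, restricted to that set. -/
def posHermitianLebesgue (F : Type) [Ring F] [StarRing F] [Algebra ℝ F] [MeasureSpace F] (N : ℕ) :
    Measure (Matrix (Fin N) (Fin N) F) :=
  (Measure.map (hermitianOfCoords (F := F) (N := N)) volume).restrict (posHermitian F N)

/-- The `2 × 2` complex matrix `[z, w; -w̄, z̄]` representing the real quaternion `z + w j`. -/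
def quaternionBlock (q : ℍ[ℝ]) : Matrix (Fin 2) (Fin 2) ℂ :=
  !![⟨q.re, q.imI⟩, ⟨q.imJ, q.imK⟩; -star (⟨q.imJ, q.imK⟩ : ℂ), star (⟨q.re, q.imI⟩ : ℂ)]

/-- The `2N × 2N` complex matrix obtained from an `N × N` quaternion matrix by replacing each entry
by its `2 × 2` block. -/
def quaternionToComplex {N : ℕ} (W : Matrix (Fin N) (Fin N) ℍ[ℝ]) :
    Matrix (Fin N × Fin 2) (Fin N × Fin 2) ℂ :=
  Matrix.of fun p q => quaternionBlock (W p.1 q.1) p.2 q.2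

/-- The determinant of a non-negative Hermitian quaternion matrix `W`. The eigenvalues
`σ₁², …, σ_N²` of `W` occur in the complex representation with multiplicity two each, so the
determinant of the latter is `∏ σ_l⁴`; its square root `∏ σ_l²` ignores the multiplicity. -/
def quaternionDet {N : ℕ} (W : Matrix (Fin N) (Fin N) ℍ[ℝ]) : ℝ :=
  Real.sqrt (quaternionToComplex W).det.re

/-- The surface area `σ_l = 2 π^{l/2} / Γ(l/2)` of the unit sphere in `ℝ^l`. -/
def sphereArea (l : ℝ) : ℝ := 2 * Real.pi ^ (l / 2) / Real.Gamma (l / 2)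

/-- The constant `∏_{i=1}^N σ_{β(n-i+1)} / σ_{β(N-i+1)}`. -/
def polarConst (β n N : ℕ) : ℝ :=
  ∏ i ∈ Finset.Icc 1 N,
    sphereArea (β * ((n : ℝ) - i + 1)) / sphereArea (β * ((N : ℝ) - i + 1))

end

/-! Let G(n,N) be the image of Lebesgue measure under M ↦ M†M (`gramMeasure`). The theorem amounts
to an identity of measures, G(n,N) = c · (det W)^{β(n-N)/2} · G(N,N), which is
`gramMeasure_eq_smul_withDensity`. It is proved by induction on N, without computing the Jacobian of
M ↦ M†M.

Fix the first column v of M. A unitary U carries v to ‖v‖e₁, and left multiplication by U changes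
neither the Gram matrix nor Lebesgue measure on the remaining columns. If a is the first row of
these columns after rotation and M' the rest, the Gram matrix depends only on r = ‖v‖, a and M'†M'.
Polar coordinates in v then present G(n+1,N+1) as the image of σ_{β(n+1)} r^{β(n+1)-1} dr da
G(n,N)(dW) under bordering (`lintegral_gramMeasure_succ`). The same recursion for G(N+1,N+1) has
another sphere area and another power of r. Bordering multiplies the determinant by r², and
(r²)^{β(n-N)/2} is exactly the missing power.

As f is only Lebesgue measurable on the Hermitian cone, f(M†M) is known to be measurable only once
G(N,N) is absolutely continuous with respect to (dW). `gramMeasure_absolutelyContinuous` proves this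
by a Fubini argument with the congruences W ↦ g†Wg.

The three algebras are treated together through `StarDivisionAlgebra`, and their determinants
through `IsGramDet`. -/

/-- A finite-dimensional real division algebra with a positive involution whose self-adjoint
elements are the reals, with a translation invariant volume normalised by the Gaussian integral. -/
class StarDivisionAlgebra (F : Type) [NormedDivisionRing F] [NormedAlgebra ℝ F] [StarRing F]
    [MeasureSpace F] where
  /-- The real part. -/
  re : F →ₗ[ℝ] ℝ
  re_algebraMap (r : ℝ) : re (algebraMap ℝ F r) = r
  algebraMap_re_of_star_eq (x : F) : star x = x → algebraMap ℝ F (re x) = x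
  star_mul_self_eq (x : F) : star x * x = algebraMap ℝ F (‖x‖ ^ 2)
  lintegral_gaussian : ∫⁻ x : F, ENNReal.ofReal (Real.exp (-‖x‖ ^ 2)) =
    ENNReal.ofReal (Real.pi ^ ((Module.finrank ℝ F : ℝ) / 2))

/-! ### Adjoining a column or a row to a matrix. -/

section Cons

variable {F : Type} {n N : ℕ}

/-- The matrix with first column `v` and remaining columns `M`. -/
def Matrix.consCol (v : Fin n → F) (M : Matrix (Fin n) (Fin N) F) :
    Matrix (Fin n) (Fin (N + 1)) F := Matrix.of fun i => Fin.cons (v i) (M i)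

/-- The matrix with first row `a` and remaining rows `M`. -/
def Matrix.consRow (a : Fin N → F) (M : Matrix (Fin n) (Fin N) F) :
    Matrix (Fin (n + 1)) (Fin N) F := Matrix.of (Fin.cons a M)

@[simp]
theorem Matrix.consRow_zero (a : Fin N → F) (M : Matrix (Fin n) (Fin N) F) (j : Fin N) :
    Matrix.consRow a M 0 j = a j := rfl

@[simp]
theorem Matrix.consRow_succ (a : Fin N → F) (M : Matrix (Fin n) (Fin N) F) (i : Fin n)
    (j : Fin N) : Matrix.consRow a M i.succ j = M i j := rfl

end Cons

theorem pi_const_isAddHaarMeasure (E : Type) [NormedAddCommGroup E] [MeasurableSpace E]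
    [BorelSpace E] (μ : Measure E) [SigmaFinite μ] [SecondCountableTopology E]
    [μ.IsAddHaarMeasure] (ι : Type) [Fintype ι] : (Measure.pi fun _ : ι => μ).IsAddHaarMeasure :=
  inferInstance

/-! ### Lebesgue measure on matrices and its invariance under unitaries. -/

section General

set_option linter.unusedSectionVars false

variable {F : Type} [NormedDivisionRing F] [NormedAlgebra ℝ F] [StarRing F] [StarModule ℝ F]
  [MeasureSpace F] [BorelSpace F] [FiniteDimensional ℝ F] [(volume : Measure F).IsAddHaarMeasure]
  {n N : ℕ}

instance secondCountableTopology_of_finiteDimensional : SecondCountableTopology F :=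
  have := FiniteDimensional.proper ℝ F
  inferInstance

instance matrixBorelSpace : BorelSpace (Matrix (Fin n) (Fin N) F) :=
  inferInstanceAs (BorelSpace (Fin n → Fin N → F))

instance matrixLebesgue_isAddHaarMeasure : (matrixLebesgue F n N).IsAddHaarMeasure :=
  pi_const_isAddHaarMeasure (Fin N → F) (Measure.pi fun _ => volume) (Fin n)

instance matrixLebesgue_sigmaFinite : SigmaFinite (matrixLebesgue F n N) :=
  inferInstanceAs (SigmaFinite
    (Measure.pi fun _ : Fin n => Measure.pi fun _ : Fin N => (volume : Measure F)))

instance matrix_secondCountable : SecondCountableTopology (Matrix (Fin n) (Fin N) F) :=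
  inferInstanceAs (SecondCountableTopology (Fin n → Fin N → F))

instance : ContinuousStar F := by
  have : Continuous (starLinearEquiv ℝ (A := F)).toLinearMap :=
    LinearMap.continuous_of_finiteDimensional _
  exact ⟨this⟩

theorem measurePreserving_consRow :
    MeasurePreserving (fun p : (Fin N → F) × Matrix (Fin n) (Fin N) F => Matrix.consRow p.1 p.2)
      ((Measure.pi fun _ => volume).prod (matrixLebesgue F n N)) (matrixLebesgue F (n + 1) N) := by
  have h := (measurePreserving_piFinSuccAbove (n := n) (α := fun _ => Fin N → F)
    (fun _ => Measure.pi fun _ => (volume : Measure F)) 0).symm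
  have he : (fun p : (Fin N → F) × Matrix (Fin n) (Fin N) F => Matrix.consRow p.1 p.2) =
      (MeasurableEquiv.piFinSuccAbove (fun _ : Fin (n + 1) => Fin N → F) 0).symm := by
    ext p : 1
    exact (Fin.insertNth_zero' p.1 p.2).symm
  rw [he]
  exact h

theorem measurePreserving_consCol :
    MeasurePreserving (fun p : (Fin n → F) × Matrix (Fin n) (Fin N) F => Matrix.consCol p.1 p.2)
      ((Measure.pi fun _ => volume).prod (matrixLebesgue F n N)) (matrixLebesgue F n (N + 1)) := by
  have h := (measurePreserving_piFinSuccAbove (n := N) (α := fun _ => F)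
    (fun _ => (volume : Measure F)) 0).symm
  have h2 := measurePreserving_pi (ι := Fin n) _ _ (fun _ => h)
  have h3 := (measurePreserving_arrowProdEquivProdArrow F (Fin N → F) (Fin n)
    (fun _ => volume) (fun _ => Measure.pi fun _ => volume)).symm
  have he : (fun p : (Fin n → F) × Matrix (Fin n) (Fin N) F => Matrix.consCol p.1 p.2) =
      (fun a i => (MeasurableEquiv.piFinSuccAbove (fun _ : Fin (N + 1) => F) 0).symm (a i)) ∘
      (MeasurableEquiv.arrowProdEquivProdArrow F (Fin N → F) (Fin n)).symm := by
    ext p : 1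
    funext i
    exact (Fin.insertNth_zero' (p.1 i) (p.2 i)).symm
  rw [he]
  exact h2.comp h3

/-- An injective linear map preserving a bounded neighbourhood
of the origin preserves additive Haar measures. -/
theorem LinearMap.measurePreserving_of_preimage_eq {E : Type*} [NormedAddCommGroup E]
    [NormedSpace ℝ E] [FiniteDimensional ℝ E] [MeasurableSpace E] [BorelSpace E] (μ : Measure E)
    [μ.IsAddHaarMeasure] (L : E →ₗ[ℝ] E) (hL : Function.Injective L) {s : Set E}
    (hs : s ∈ nhds 0) (hb : Bornology.IsBounded s) (hLs : L ⁻¹' s = s) : MeasurePreserving L μ μ := by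
  have hdet : LinearMap.det L ≠ 0 := by
    have := (LinearEquiv.ofInjectiveEndo L hL).isUnit_det'
    exact this.ne_zero
  have hμ := Measure.addHaar_preimage_linearMap μ hdet s
  rw [hLs] at hμ
  have h0 : μ s ≠ 0 := (Measure.measure_pos_of_mem_nhds μ hs).ne'
  have h1 : μ s ≠ ⊤ := hb.measure_lt_top.ne
  refine ⟨(LinearMap.continuous_of_finiteDimensional L).measurable, ?_⟩
  rw [Measure.map_linearMap_addHaar_eq_smul_addHaar μ hdet]
  have : ENNReal.ofReal |(LinearMap.det L)⁻¹| = 1 := by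
    rw [← ENNReal.mul_left_inj h0 h1, ← hμ, one_mul]
  rw [this, one_smul]

theorem Matrix.conjTranspose_mul_mul_self_of_unitary {U : Matrix (Fin n) (Fin n) F} (hU : Uᴴ * U = 1)
    (M : Matrix (Fin n) (Fin N) F) : (U * M)ᴴ * (U * M) = Mᴴ * M := by
  rw [Matrix.conjTranspose_mul, Matrix.mul_assoc, ← Matrix.mul_assoc Uᴴ, hU, Matrix.one_mul]

variable [StarDivisionAlgebra F]
open StarDivisionAlgebra

theorem star_dotProduct_self_eq (v : Fin n → F) :
    star v ⬝ᵥ v = algebraMap ℝ F (∑ i, ‖v i‖ ^ 2) := by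
  simp [dotProduct, star_mul_self_eq]

theorem Matrix.sum_norm_sq_unitary_mul {U : Matrix (Fin n) (Fin n) F} (hU : Uᴴ * U = 1)
    (M : Matrix (Fin n) (Fin N) F) (j : Fin N) :
    ∑ i, ‖(U * M) i j‖ ^ 2 = ∑ i, ‖M i j‖ ^ 2 := by
  have h := congrFun (congrFun (Matrix.conjTranspose_mul_mul_self_of_unitary hU M) j) j
  have key (A : Matrix (Fin n) (Fin N) F) : (Aᴴ * A) j j = algebraMap ℝ F (∑ i, ‖A i j‖ ^ 2) := by
    rw [← star_dotProduct_self_eq (fun i => A i j)]; rfl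
  rw [key, key] at h
  exact (algebraMap ℝ F).injective h

/-- A unitary preserves the Euclidean norm of every column, hence the bounded open set of matrices
whose columns all have norm below 1. This forces the real determinant of the map to be ±1 without
any determinant over the possibly noncommutative `F`. -/
theorem measurePreserving_unitary_mul {U : Matrix (Fin n) (Fin n) F} (hU : Uᴴ * U = 1) :
    MeasurePreserving (fun M : Matrix (Fin n) (Fin N) F => U * M) (matrixLebesgue F n N)
      (matrixLebesgue F n N) := by
  let L : (Fin n → Fin N → F) →ₗ[ℝ] (Fin n → Fin N → F) :=
    { toFun := fun M => U * Matrix.of M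
      map_add' := fun A B => Matrix.mul_add U (Matrix.of A) (Matrix.of B)
      map_smul' := fun c M => Matrix.mul_smul U c (Matrix.of M) }
  have := pi_const_isAddHaarMeasure (Fin N → F) (Measure.pi fun _ => (volume : Measure F)) (Fin n)
  refine LinearMap.measurePreserving_of_preimage_eq
    (Measure.pi fun _ : Fin n => Measure.pi fun _ : Fin N => (volume : Measure F)) L ?_
    (s := {M | ∀ j, ∑ i, ‖M i j‖ ^ 2 < 1}) ?_ ?_ ?_
  · intro A B h
    have h' : U * Matrix.of A = U * Matrix.of B := h
    have := congrArg (fun C => Uᴴ * C) h'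
    simpa [← Matrix.mul_assoc, hU] using this
  · apply IsOpen.mem_nhds
    · simp only [Set.ofPred_forall]
      refine isOpen_iInter_of_finite fun j => isOpen_lt ?_ continuous_const
      exact continuous_finsetSum _ fun i _ => ((continuous_apply_apply i j).norm.pow 2)
    · simp
  · refine (Metric.isBounded_closedBall (x := (0 : Fin n → Fin N → F)) (r := 1)).subset ?_
    intro M hM
    rw [mem_closedBall_zero_iff, pi_norm_le_iff_of_nonneg zero_le_one]
    intro i
    rw [pi_norm_le_iff_of_nonneg zero_le_one]
    intro j
    have h1 : ‖M i j‖ ^ 2 ≤ ∑ i, ‖M i j‖ ^ 2 :=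
      Finset.single_le_sum (f := fun i => ‖M i j‖ ^ 2) (fun _ _ => by positivity) (Finset.mem_univ i)
    have h2 := hM j
    exact abs_le_one_iff_mul_self_le_one.2 (by nlinarith) |> (le_abs_self _).trans
  · ext M
    simp only [Set.mem_preimage, Set.mem_ofPred_eq]
    exact forall_congr' fun j => by rw [← Matrix.sum_norm_sq_unitary_mul hU M j]; rfl

end General

/-! ### Rotating a vector to the first axis; polar coordinates. -/

section General
set_option linter.unusedSectionVars false

variable {F : Type} [NormedDivisionRing F] [NormedAlgebra ℝ F] [StarRing F] [StarModule ℝ F]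
  [MeasureSpace F] [BorelSpace F] [FiniteDimensional ℝ F] [(volume : Measure F).IsAddHaarMeasure]
  [StarDivisionAlgebra F] {n N : ℕ}
open StarDivisionAlgebra

/-- The Euclidean norm of a vector with entries in `F`. -/
noncomputable def euclideanNorm (v : Fin n → F) : ℝ := Real.sqrt (∑ i, ‖v i‖ ^ 2)

theorem euclideanNorm_sq (v : Fin n → F) : euclideanNorm v ^ 2 = ∑ i, ‖v i‖ ^ 2 :=
  Real.sq_sqrt (Finset.sum_nonneg fun _ _ => by positivity)

theorem exists_phase (x : F) : ∃ α : F, star α * α = 1 ∧ star α * x = algebraMap ℝ F ‖x‖ := by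
  by_cases hx : x = 0
  · exact ⟨1, by simp, by simp [hx]⟩
  · have hx' : ‖x‖ ≠ 0 := norm_ne_zero_iff.2 hx
    refine ⟨‖x‖⁻¹ • x, ?_, ?_⟩
    · rw [star_mul_self_eq, norm_smul]
      simp [hx']
    · rw [star_smul, smul_mul_assoc, star_mul_self_eq, star_trivial, Algebra.smul_def, ← map_mul]
      congr 1
      field_simp

theorem star_algebraMap_real (r : ℝ) : star (algebraMap ℝ F r) = algebraMap ℝ F r := by
  rw [← algebraMap_star_comm, star_trivial]

/-- The Householder reflection along `w`. -/
theorem exists_householder (w : Fin n → F) : ∃ U : Matrix (Fin n) (Fin n) F,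
    Uᴴ * U = 1 ∧ ∀ v : Fin n → F, star w ⬝ᵥ v = algebraMap ℝ F ((∑ i, ‖w i‖ ^ 2) / 2) →
      U *ᵥ v = v - w := by
  by_cases hw : w = 0
  · exact ⟨1, by simp, fun v _ => by simp [hw]⟩
  set s : ℝ := ∑ i, ‖w i‖ ^ 2 with hs
  have hs0 : s ≠ 0 := by
    obtain ⟨i, hi⟩ := Function.ne_iff.1 hw
    refine (Finset.sum_pos' (fun _ _ => by positivity) ⟨i, Finset.mem_univ i, ?_⟩).ne'
    have : 0 < ‖w i‖ := norm_pos_iff.2 hi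
    positivity
  set P := Matrix.vecMulVec w (star w) with hP
  have hPH : Pᴴ = P := by rw [hP, Matrix.conjTranspose_vecMulVec, star_star]
  have hPP : P * P = s • P := by
    ext i j
    simp only [hP, Matrix.mul_apply, Matrix.vecMulVec_apply, Matrix.smul_apply]
    have : ∀ k, w i * star w k * (w k * star w j) = w i * (star w k * w k) * star w j :=
      fun k => by simp only [mul_assoc]
    simp_rw [this, ← Finset.sum_mul, ← Finset.mul_sum]
    have h := star_dotProduct_self_eq w
    rw [dotProduct] at h
    rw [h, ← hs, Algebra.smul_def, ← Algebra.commutes, mul_assoc]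
  refine ⟨1 - (2 / s) • P, ?_, ?_⟩
  · rw [Matrix.conjTranspose_sub, Matrix.conjTranspose_smul, hPH, Matrix.conjTranspose_one,
      star_trivial, Matrix.mul_sub, Matrix.mul_one, Matrix.sub_mul, Matrix.one_mul, smul_mul_smul_comm,
      hPP, smul_smul]
    have : 2 / s * (2 / s) * s = 2 / s + 2 / s := by field_simp; norm_num
    rw [this, add_smul]
    abel
  · intro v hv
    rw [Matrix.sub_mulVec, Matrix.one_mulVec, Matrix.smul_mulVec, hP]
    congr 1
    ext i
    have : (Matrix.vecMulVec w (star w) *ᵥ v) i = w i * (star w ⬝ᵥ v) := by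
      simp only [Matrix.mulVec, dotProduct, Matrix.vecMulVec_apply, Finset.mul_sum, mul_assoc]
    rw [Pi.smul_apply, this, hv, Algebra.smul_def, ← Algebra.commutes, ← mul_assoc, ← map_mul]
    have : 2 / s * (s / 2) = 1 := by field_simp
    rw [this]; simp

/-- The vector e has the norm of v and a phase α making the product of e and v real, so the
reflection along v - e sends v to e. A diagonal unitary then removes the phase. -/
theorem exists_unitary_mulVec_eq_single (v : Fin (n + 1) → F) :
    ∃ U : Matrix (Fin (n + 1)) (Fin (n + 1)) F, Uᴴ * U = 1 ∧
      U *ᵥ v = Pi.single 0 (algebraMap ℝ F (euclideanNorm v)) := by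
  obtain ⟨α, hα, hαv⟩ := exists_phase (v 0)
  set R := euclideanNorm v with hR
  set e : Fin (n + 1) → F := Pi.single 0 (α * algebraMap ℝ F R) with he
  have hvv : star v ⬝ᵥ v = algebraMap ℝ F (R ^ 2) := by
    rw [star_dotProduct_self_eq, euclideanNorm_sq]
  have hev : star e ⬝ᵥ v = algebraMap ℝ F (R * ‖v 0‖) := by
    rw [he, ← Pi.single_star, single_dotProduct, star_mul, star_algebraMap_real, mul_assoc, hαv,
      map_mul]
  have hve : star v ⬝ᵥ e = algebraMap ℝ F (R * ‖v 0‖) := by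
    have := congrArg star hev
    rwa [star_algebraMap_real, ← Matrix.star_dotProduct_star, star_star] at this
  have hee : star e ⬝ᵥ e = algebraMap ℝ F (R ^ 2) := by
    rw [he, ← Pi.single_star, single_dotProduct, Pi.single_eq_same, star_mul, star_algebraMap_real,
      mul_assoc, ← mul_assoc (star α), hα, one_mul, ← map_mul, sq]
  obtain ⟨U, hU, hUv⟩ := exists_householder (v - e)
  -- Equal norms and a real inner product give ‖v - e‖²/2 = R² - R‖v 0‖, which is also the product
  -- of v - e with v, as the reflection requires.
  have hs : (∑ i, ‖(v - e) i‖ ^ 2) / 2 = R ^ 2 - R * ‖v 0‖ := by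
    have h := star_dotProduct_self_eq (v - e)
    rw [star_sub, sub_dotProduct, dotProduct_sub, dotProduct_sub, hvv, hve, hev, hee, ← map_sub,
      ← map_sub, ← map_sub] at h
    have := (algebraMap ℝ F).injective h
    linarith
  have hUv' := hUv v (by rw [hs, star_sub, sub_dotProduct, hvv, hev, map_sub])
  rw [sub_sub_cancel] at hUv'
  set d : Fin (n + 1) → F := Function.update 1 0 (star α) with hd
  have hdd : ∀ i, star (d i) * d i = 1 := by
    intro i
    by_cases h : i = 0
    · subst h
      have h0 : α ≠ 0 := fun h => by simp [h] at hα
      have : star α = α⁻¹ := eq_inv_of_mul_eq_one_left hα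
      simp [hd, this, h0]
    · simp [hd, h]
  refine ⟨Matrix.diagonal d * U, ?_, ?_⟩
  · rw [Matrix.conjTranspose_mul, Matrix.mul_assoc, ← Matrix.mul_assoc _ _ U,
      Matrix.diagonal_conjTranspose, Matrix.diagonal_mul_diagonal]
    have : (fun i => star d i * d i) = 1 := funext hdd
    rw [this, Matrix.diagonal_one', Matrix.one_mul, hU]
  · rw [← Matrix.mulVec_mulVec, hUv', he]
    ext i
    rw [Matrix.mulVec_diagonal]
    by_cases h : i = 0
    · subst h
      simp [hd, ← mul_assoc, hα]
    · simp [h]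

instance withLp_map_isAddHaarMeasure :
    (Measure.map (WithLp.toLp 2 : (Fin n → F) → PiLp 2 fun _ : Fin n => F)
      (Measure.pi fun _ => volume)).IsAddHaarMeasure :=
  (PiLp.continuousLinearEquiv 2 ℝ (fun _ : Fin n => F)).symm.isAddHaarMeasure_map _

theorem lintegral_fun_norm_addHaar {E : Type*} [NormedAddCommGroup E] [NormedSpace ℝ E]
    [MeasurableSpace E] [Nontrivial E] (μ : Measure E) [FiniteDimensional ℝ E] [BorelSpace E]
    [μ.IsAddHaarMeasure] {f : ℝ → ENNReal} (hf : Measurable f) :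
    ∫⁻ x, f ‖x‖ ∂μ = μ.toSphere Set.univ *
      ∫⁻ y in Set.Ioi (0 : ℝ), ENNReal.ofReal (y ^ (Module.finrank ℝ E - 1)) * f y := by
  calc
    ∫⁻ x, f ‖x‖ ∂μ = ∫⁻ x : ({(0)}ᶜ : Set E), f ‖x.1‖ ∂(μ.comap (↑)) := by
      rw [lintegral_subtype_comap (measurableSet_singleton _).compl fun x => f ‖x‖,
        restrict_compl_singleton]
    _ = ∫⁻ x, f x.2 ∂μ.toSphere.prod (.volumeIoiPow (Module.finrank ℝ E - 1)) := by
      rw [← μ.measurePreserving_homeomorphUnitSphereProd.lintegral_comp_emb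
        (Homeomorph.measurableEmbedding _) (fun x => f x.2)]
      simp
    _ = μ.toSphere Set.univ *
        ∫⁻ x : Set.Ioi (0 : ℝ), f x ∂.volumeIoiPow (Module.finrank ℝ E - 1) := by
      rw [lintegral_prod _ (by fun_prop)]
      simp [mul_comm]
    _ = _ := by
      rw [Measure.volumeIoiPow, lintegral_withDensity_eq_lintegral_mul _ (by fun_prop)
        (by fun_prop)]
      congr 1
      exact lintegral_subtype_comap measurableSet_Ioi
        (fun y => ENNReal.ofReal (y ^ (Module.finrank ℝ E - 1)) * f y)

theorem norm_toLp_eq_euclideanNorm (v : Fin n → F) :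
    ‖(WithLp.toLp 2 v : PiLp 2 fun _ : Fin n => F)‖ = euclideanNorm v := by
  rw [PiLp.norm_eq_of_L2, euclideanNorm]

/-- The function space carries the sup norm, so the measure is moved to `PiLp 2` before passing to
polar coordinates. The constant κ does not depend on f, so a single test function determines it. -/
theorem exists_lintegral_euclideanNorm (m : ℕ) : ∃ κ : ENNReal, ∀ f : ℝ → ENNReal, Measurable f →
    ∫⁻ v : Fin (m + 1) → F, f (euclideanNorm v) ∂(Measure.pi fun _ => volume) =
      κ * ∫⁻ y in Set.Ioi (0 : ℝ),
        ENNReal.ofReal (y ^ (Module.finrank ℝ F * (m + 1) - 1)) * f y := by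
  set μ := Measure.map (WithLp.toLp 2 : (Fin (m + 1) → F) → PiLp 2 fun _ : Fin (m + 1) => F)
      (Measure.pi fun _ => volume) with hμ
  have hd : Module.finrank ℝ (PiLp 2 fun _ : Fin (m + 1) => F) = Module.finrank ℝ F * (m + 1) := by
    rw [(PiLp.continuousLinearEquiv 2 ℝ (fun _ : Fin (m + 1) => F)).toLinearEquiv.finrank_eq,
      Module.finrank_pi_fintype]
    simp [mul_comm]
  refine ⟨μ.toSphere Set.univ, fun f hf => ?_⟩
  rw [← hd, ← lintegral_fun_norm_addHaar μ hf, hμ, lintegral_map (by fun_prop) (by fun_prop)]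
  simp_rw [norm_toLp_eq_euclideanNorm]

theorem lintegral_pi_prod_eq_pow {E : Type*} [MeasurableSpace E] (μ : Measure E) [SigmaFinite μ]
    {f : E → ENNReal} (hf : Measurable f) (m : ℕ) :
    ∫⁻ v : Fin m → E, ∏ i, f (v i) ∂(Measure.pi fun _ => μ) = (∫⁻ x, f x ∂μ) ^ m := by
  induction m with
  | zero => simp
  | succ m ih =>
    rw [← (measurePreserving_piFinSuccAbove (n := m) (α := fun _ => E) (fun _ => μ)
      0).symm.lintegral_comp (by fun_prop)]
    simp_rw [Fin.prod_univ_succ]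
    simp only [MeasurableEquiv.piFinSuccAbove_symm_apply, Fin.insertNthEquiv_zero,
      Fin.consEquiv_apply, Fin.cons_zero, Fin.cons_succ]
    rw [lintegral_prod_mul (g := fun v : Fin m → E => ∏ i, f (v i)) hf.aemeasurable
      (Finset.measurable_fun_prod _ fun i _ => hf.comp (measurable_pi_apply i)).aemeasurable, ih, pow_succ']

theorem lintegral_gaussian_pi (m : ℕ) :
    ∫⁻ v : Fin m → F, ENNReal.ofReal (Real.exp (-euclideanNorm v ^ 2))
      ∂(Measure.pi fun _ => volume) =
      ENNReal.ofReal (Real.pi ^ ((Module.finrank ℝ F * m : ℝ) / 2)) := by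
  have h (v : Fin m → F) : ENNReal.ofReal (Real.exp (-euclideanNorm v ^ 2)) =
      ∏ i, ENNReal.ofReal (Real.exp (-‖v i‖ ^ 2)) := by
    rw [euclideanNorm_sq, ← Finset.sum_neg_distrib, Real.exp_sum,
      ENNReal.ofReal_prod_of_nonneg fun _ _ => (Real.exp_pos _).le]
  simp_rw [h]
  rw [lintegral_pi_prod_eq_pow volume (f := fun x : F => ENNReal.ofReal (Real.exp (-‖x‖ ^ 2)))
    (by fun_prop), lintegral_gaussian]
  rw [← ENNReal.ofReal_pow (by positivity), ← Real.rpow_natCast, ← Real.rpow_mul Real.pi_pos.le]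
  congr 2
  ring

theorem lintegral_radial_gaussian {d : ℕ} (hd : 0 < d) :
    ∫⁻ y in Set.Ioi (0 : ℝ), ENNReal.ofReal (y ^ (d - 1)) * ENNReal.ofReal (Real.exp (-y ^ 2)) =
      ENNReal.ofReal (Real.Gamma (d / 2) / 2) := by
  have hd' : (-1 : ℝ) < (d - 1 : ℝ) := by
    have : (0 : ℝ) < d := by exact_mod_cast hd
    linarith
  have h := integral_rpow_mul_exp_neg_rpow (p := 2) (q := d - 1) two_pos hd'
  have hpos : 0 < 1 / (2 : ℝ) * Real.Gamma ((d - 1 + 1) / 2) := by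
    have : (0 : ℝ) < d := by exact_mod_cast hd
    have := Real.Gamma_pos_of_pos (s := (d - 1 + 1) / 2) (by rw [sub_add_cancel]; positivity)
    positivity
  rw [← h] at hpos
  have hint := not_imp_comm.1 integral_undef hpos.ne'
  have hg : Real.Gamma (d / 2) / 2 =
      ∫ x in Set.Ioi (0 : ℝ), x ^ (d - 1 : ℝ) * Real.exp (-x ^ (2 : ℝ)) := by
    rw [h, sub_add_cancel]
    ring
  rw [hg, ofReal_integral_eq_lintegral_ofReal hint]
  · refine setLIntegral_congr_fun measurableSet_Ioi fun y hy => ?_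
    have hy' : (0 : ℝ) < y := hy
    have hp : y ^ (d - 1 : ℝ) = y ^ (d - 1) := by
      rw [← Real.rpow_natCast, Nat.cast_sub hd, Nat.cast_one]
    simp only [hp, Real.rpow_two]
    rw [ENNReal.ofReal_mul (by positivity)]
  · filter_upwards [ae_restrict_mem measurableSet_Ioi] with y hy
    have hy' : (0 : ℝ) < y := hy
    positivity

/-- The Gaussian is the test function that evaluates κ: its full integral is π^{d/2} and its radial
integral is Γ(d/2)/2, with quotient the sphere area. -/
theorem lintegral_euclideanNorm (hF : 0 < Module.finrank ℝ F) (m : ℕ) {f : ℝ → ENNReal}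
    (hf : Measurable f) :
    ∫⁻ v : Fin (m + 1) → F, f (euclideanNorm v) ∂(Measure.pi fun _ => volume) =
      ENNReal.ofReal (sphereArea (Module.finrank ℝ F * ((m : ℝ) + 1))) *
        ∫⁻ y in Set.Ioi (0 : ℝ),
          ENNReal.ofReal (y ^ (Module.finrank ℝ F * (m + 1) - 1)) * f y := by
  obtain ⟨κ, hκ⟩ := exists_lintegral_euclideanNorm (F := F) m
  have hd : 0 < Module.finrank ℝ F * (m + 1) := by positivity
  rw [hκ f hf]
  congr 1
  have h := hκ (fun y => ENNReal.ofReal (Real.exp (-y ^ 2))) (by fun_prop)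
  have hG : 0 < Real.Gamma ((Module.finrank ℝ F * (m + 1) : ℕ) / 2) :=
    Real.Gamma_pos_of_pos (by positivity)
  rw [lintegral_gaussian_pi, lintegral_radial_gaussian hd] at h
  have h2 : (0 : ℝ) < Real.Gamma ((Module.finrank ℝ F * (m + 1) : ℕ) / 2) / 2 := by positivity
  rw [← ENNReal.mul_left_inj (ENNReal.ofReal_pos.2 h2).ne' ENNReal.ofReal_ne_top, ← h, sphereArea,
    ← ENNReal.ofReal_mul' h2.le]
  congr 1
  push_cast
  push_cast at hG
  field_simp

end General

/-! ### The distribution of Gram matrices: recursion and density. -/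

section General
set_option linter.unusedSectionVars false

variable {F : Type} [NormedDivisionRing F] [NormedAlgebra ℝ F] [StarRing F] [StarModule ℝ F]
  [MeasureSpace F] [BorelSpace F] [FiniteDimensional ℝ F] [(volume : Measure F).IsAddHaarMeasure]
  [StarDivisionAlgebra F] {n N : ℕ}
open StarDivisionAlgebra

theorem continuous_gram :
    Continuous (fun M : Matrix (Fin n) (Fin N) F => Mᴴ * M) := by
  fun_prop

variable (F n N) in
/-- The distribution of `Mᴴ * M`. -/
noncomputable def gramMeasure : Measure (Matrix (Fin N) (Fin N) F) :=
  Measure.map (fun M : Matrix (Fin n) (Fin N) F => Mᴴ * M) (matrixLebesgue F n N)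

theorem lintegral_gramMeasure {g : Matrix (Fin N) (Fin N) F → ENNReal} (hg : Measurable g) :
    ∫⁻ W, g W ∂(gramMeasure F n N) = ∫⁻ M, g (Mᴴ * M) ∂(matrixLebesgue F n N) :=
  lintegral_map hg continuous_gram.measurable

/-- The Gram matrix obtained by bordering `W`. -/
noncomputable def borderedGram (r : ℝ) (a : Fin N → F) (W : Matrix (Fin N) (Fin N) F) :
    Matrix (Fin (N + 1)) (Fin (N + 1)) F :=
  Matrix.of (Fin.cons (Fin.cons (algebraMap ℝ F (r ^ 2)) fun j => algebraMap ℝ F r * a j)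
    fun i => Fin.cons (star (a i) * algebraMap ℝ F r) fun j => star (a i) * a j + W i j)

theorem gram_consCol_single (r : ℝ) (a : Fin N → F) (M : Matrix (Fin n) (Fin N) F) :
    (Matrix.consCol (Pi.single 0 (algebraMap ℝ F r)) (Matrix.consRow a M))ᴴ *
      Matrix.consCol (Pi.single 0 (algebraMap ℝ F r)) (Matrix.consRow a M) =
      borderedGram r a (Mᴴ * M) := by
  ext i j
  refine Fin.cases ?_ (fun i => ?_) i <;> refine Fin.cases ?_ (fun j => ?_) j <;>
    simp [Matrix.mul_apply, Fin.sum_univ_succ, borderedGram, Matrix.consCol, star_algebraMap_real, sq]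

theorem continuous_borderedGram :
    Continuous (fun p : (ℝ × (Fin N → F)) × Matrix (Fin N) (Fin N) F =>
      borderedGram p.1.1 p.1.2 p.2) := by
  have := (algebraMapCLM ℝ F).continuous
  have halg : Continuous (algebraMap ℝ F) := this
  refine continuous_matrix fun i j => ?_
  refine Fin.cases ?_ (fun i => ?_) i <;> refine Fin.cases ?_ (fun j => ?_) j <;>
    simp only [borderedGram, Matrix.of_apply, Fin.cons_zero, Fin.cons_succ] <;> fun_prop

theorem continuous_consCol :
    Continuous (fun p : (Fin n → F) × Matrix (Fin n) (Fin N) F => Matrix.consCol p.1 p.2) := by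
  refine continuous_matrix fun i j => ?_
  refine Fin.cases ?_ (fun j => ?_) j <;>
    simp only [Matrix.consCol, Matrix.of_apply, Fin.cons_zero, Fin.cons_succ] <;> fun_prop

theorem Matrix.mul_consCol (U : Matrix (Fin n) (Fin n) F) (v : Fin n → F)
    (M : Matrix (Fin n) (Fin N) F) :
    U * Matrix.consCol v M = Matrix.consCol (U *ᵥ v) (U * M) := by
  ext i j
  refine Fin.cases ?_ (fun j => ?_) j <;>
    simp [Matrix.mul_apply, Matrix.consCol, Matrix.mulVec, dotProduct]

/-- After rotation of v to the first axis, the top row a of the remaining columns meets v only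
through r, and the rows below it contribute their own Gram matrix, one row shorter. The integral
thus depends on v only through its norm. -/
theorem lintegral_gram_consCol {g : Matrix (Fin (N + 1)) (Fin (N + 1)) F → ENNReal}
    (hg : Measurable g) (v : Fin (n + 1) → F) :
    ∫⁻ M, g ((Matrix.consCol v M)ᴴ * Matrix.consCol v M) ∂(matrixLebesgue F (n + 1) N) =
      ∫⁻ a, ∫⁻ W, g (borderedGram (euclideanNorm v) a W) ∂(gramMeasure F n N)
        ∂(Measure.pi fun _ => volume) := by
  obtain ⟨U, hU, hUv⟩ := exists_unitary_mulVec_eq_single v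
  set e : Fin (n + 1) → F := Pi.single 0 (algebraMap ℝ F (euclideanNorm v)) with he
  have hb := continuous_borderedGram (F := F) (N := N)
  have hmeas (w : Fin (n + 1) → F) : Measurable fun M : Matrix (Fin (n + 1)) (Fin N) F =>
      g ((Matrix.consCol w M)ᴴ * Matrix.consCol w M) :=
    hg.comp (continuous_gram.comp (continuous_consCol.comp (by fun_prop :
      Continuous fun M : Matrix (Fin (n + 1)) (Fin N) F => (w, M)))).measurable
  calc
    _ = ∫⁻ M, g ((Matrix.consCol e (U * M))ᴴ * Matrix.consCol e (U * M))
          ∂(matrixLebesgue F (n + 1) N) := by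
      refine lintegral_congr fun M => ?_
      rw [← Matrix.conjTranspose_mul_mul_self_of_unitary hU (Matrix.consCol v M),
        Matrix.mul_consCol, hUv]
    _ = ∫⁻ M, g ((Matrix.consCol e M)ᴴ * Matrix.consCol e M) ∂(matrixLebesgue F (n + 1) N) :=
      (measurePreserving_unitary_mul hU).lintegral_comp (hmeas e)
    _ = ∫⁻ p : (Fin N → F) × Matrix (Fin n) (Fin N) F,
          g (borderedGram (euclideanNorm v) p.1 (p.2ᴴ * p.2))
          ∂((Measure.pi fun _ => volume).prod (matrixLebesgue F n N)) := by
      rw [← measurePreserving_consRow.lintegral_comp (hmeas e)]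
      simp only [he, gram_consCol_single]
    _ = _ := by
      rw [lintegral_prod]
      · refine lintegral_congr fun a => ?_
        rw [lintegral_gramMeasure]
        exact hg.comp (hb.comp (by fun_prop : Continuous fun W => ((euclideanNorm v, a), W))).measurable
      · exact (hg.comp (hb.comp (by fun_prop : Continuous
          fun p : (Fin N → F) × Matrix (Fin n) (Fin N) F =>
            ((euclideanNorm v, p.1), p.2ᴴ * p.2))).measurable).aemeasurable

instance : SFinite (gramMeasure F n N) := by
  unfold gramMeasure
  infer_instance

theorem measurable_lintegral_borderedGram (ν : Measure (Matrix (Fin N) (Fin N) F)) [SFinite ν]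
    {g : ℝ → Matrix (Fin (N + 1)) (Fin (N + 1)) F → ENNReal} (hg : Measurable (Function.uncurry g)) :
    Measurable fun r : ℝ => ∫⁻ a, ∫⁻ W, g r (borderedGram r a W) ∂ν
        ∂(Measure.pi fun _ => (volume : Measure F)) := by
  have h : Measurable fun p : (ℝ × (Fin N → F)) × Matrix (Fin N) (Fin N) F =>
      g p.1.1 (borderedGram p.1.1 p.1.2 p.2) :=
    hg.comp (measurable_fst.fst.prodMk continuous_borderedGram.measurable)
  exact h.lintegral_prod_right'.lintegral_prod_right'

theorem lintegral_gramMeasure_succ (hF : 0 < Module.finrank ℝ F)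
    {g : Matrix (Fin (N + 1)) (Fin (N + 1)) F → ENNReal} (hg : Measurable g) :
    ∫⁻ W, g W ∂(gramMeasure F (n + 1) (N + 1)) =
      ENNReal.ofReal (sphereArea (Module.finrank ℝ F * ((n : ℝ) + 1))) *
        ∫⁻ r in Set.Ioi (0 : ℝ), ENNReal.ofReal (r ^ (Module.finrank ℝ F * (n + 1) - 1)) *
          ∫⁻ a, ∫⁻ W, g (borderedGram r a W) ∂(gramMeasure F n N)
            ∂(Measure.pi fun _ => volume) := by
  rw [← lintegral_euclideanNorm hF n
    (measurable_lintegral_borderedGram _ (g := fun _ => g) (hg.comp measurable_snd)),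
    lintegral_gramMeasure hg,
    ← measurePreserving_consCol.lintegral_comp (f := fun M => g (Mᴴ * M))
      (hg.comp continuous_gram.measurable),
    lintegral_prod]
  · exact lintegral_congr fun v => lintegral_gram_consCol hg v
  · exact (hg.comp (continuous_gram.comp continuous_consCol).measurable).aemeasurable

theorem sphereArea_pos {l : ℝ} (hl : 0 < l) : 0 < sphereArea l := by
  have := Real.Gamma_pos_of_pos (half_pos hl)
  unfold sphereArea
  positivity

theorem polarConst_pos {β : ℕ} (hβ : 0 < β) (h : N ≤ n) : 0 < polarConst β n N := by
  refine Finset.prod_pos fun i hi => ?_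
  have hi := (Finset.mem_Icc.1 hi).2
  have h1 : (i : ℝ) ≤ N := by exact_mod_cast hi
  have h2 : (N : ℝ) ≤ n := by exact_mod_cast h
  have h3 : (0 : ℝ) < β := by exact_mod_cast hβ
  exact div_pos (sphereArea_pos (mul_pos h3 (by linarith)))
    (sphereArea_pos (mul_pos h3 (by linarith)))

/-- Raising n and N together shifts the index: the factors i ≥ 2 form the old product, and the
factor i = 1 is the ratio of the two new sphere areas. -/
theorem polarConst_succ {β : ℕ} (hβ : 0 < β) :
    polarConst β (n + 1) (N + 1) * sphereArea (β * ((N : ℝ) + 1)) =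
      sphereArea (β * ((n : ℝ) + 1)) * polarConst β n N := by
  have h3 : (0 : ℝ) < β := by exact_mod_cast hβ
  have h := (sphereArea_pos (l := β * ((N : ℝ) + 1)) (by positivity)).ne'
  have hI (f : ℕ → ℝ) (m : ℕ) : ∏ i ∈ Finset.Icc 1 m, f i = ∏ i ∈ Finset.range m, f (i + 1) := by
    rw [Finset.range_eq_Ico, Finset.prod_Ico_add' f 0 m 1]
    rfl
  unfold polarConst
  rw [hI, hI, Finset.prod_range_succ']
  have h1 (m i : ℕ) : ((m + 1 : ℕ) : ℝ) - ((i + 1 + 1 : ℕ) : ℝ) + 1 = m - ((i + 1 : ℕ) : ℝ) + 1 := by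
    push_cast; ring
  have h2 (m : ℕ) : ((m + 1 : ℕ) : ℝ) - ((0 + 1 : ℕ) : ℝ) + 1 = m + 1 := by
    push_cast; ring
  simp only [h1, h2]
  field_simp

/-- The properties of a determinant on Gram matrices used in the polar decomposition. -/
structure IsGramDet (D : ∀ N : ℕ, Matrix (Fin N) (Fin N) F → ℝ) : Prop where
  measurable : ∀ N, Measurable (D N)
  eq_one : ∀ W, D 0 W = 1
  nonneg : ∀ N (M : Matrix (Fin N) (Fin N) F), 0 ≤ D N (Mᴴ * M)
  bordered : ∀ N (r : ℝ) (a : Fin N → F) (M : Matrix (Fin N) (Fin N) F),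
    D (N + 1) (borderedGram r a (Mᴴ * M)) = r ^ 2 * D N (Mᴴ * M)

/-- Base of the induction: there is one matrix without columns, and Lebesgue measure, an empty
product in each row, gives it mass 1 for every n. -/
theorem gramMeasure_zero : gramMeasure F n 0 = gramMeasure F 0 0 := by
  have h1 (m : ℕ) : matrixLebesgue F m 0 Set.univ = 1 := by
    change (Measure.pi fun _ : Fin m => Measure.pi fun _ : Fin 0 => (volume : Measure F))
      Set.univ = 1
    rw [Measure.pi_univ]
    simp
  ext s hs
  rcases s.eq_empty_or_nonempty with rfl | hs'
  · simp
  · rw [Subsingleton.eq_univ_of_nonempty hs', gramMeasure, gramMeasure,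
      Measure.map_apply continuous_gram.measurable MeasurableSet.univ,
      Measure.map_apply continuous_gram.measurable MeasurableSet.univ, Set.preimage_univ,
      Set.preimage_univ, h1, h1]

theorem gramMeasure_eq_smul_withDensity (hF : 0 < Module.finrank ℝ F)
    {D : ∀ N : ℕ, Matrix (Fin N) (Fin N) F → ℝ} (hD : IsGramDet D) (hN : N ≤ n) :
    gramMeasure F n N = ENNReal.ofReal (polarConst (Module.finrank ℝ F) n N) •
      (gramMeasure F N N).withDensity fun W =>
        ENNReal.ofReal (D N W ^ ((Module.finrank ℝ F : ℝ) * ((n : ℝ) - N) / 2)) := by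
  induction N generalizing n with
  | zero => simp [polarConst, hD.eq_one, gramMeasure_zero (n := n)]
  | succ N ih =>
    obtain ⟨n, rfl⟩ := Nat.exists_eq_add_of_le' (Nat.one_le_of_lt hN)
    have hN' : N ≤ n := Nat.le_of_succ_le_succ hN
    have ih' := ih hN'
    set p : ℝ := (Module.finrank ℝ F : ℝ) * ((n : ℝ) - N) / 2 with hp
    have hp' : (Module.finrank ℝ F : ℝ) * (((n + 1 : ℕ) : ℝ) - (N + 1 : ℕ)) / 2 = p := by
      rw [hp]; push_cast; ring
    have hm (N : ℕ) : Measurable fun W => ENNReal.ofReal (D N W ^ p) := by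
      have := hD.measurable N
      fun_prop
    rw [hp']
    refine Measure.ext_of_lintegral _ fun g hg => ?_
    rw [lintegral_smul_measure, lintegral_withDensity_eq_lintegral_mul _ (hm _) hg,
      lintegral_gramMeasure_succ hF hg, lintegral_gramMeasure_succ hF ((hm _).mul hg), ih',
      smul_eq_mul, ← mul_assoc, ← ENNReal.ofReal_mul (polarConst_pos hF hN).le, polarConst_succ hF,
      ENNReal.ofReal_mul (sphereArea_pos (by positivity)).le, mul_assoc]
    congr 1
    rw [← lintegral_const_mul' _ _ ENNReal.ofReal_ne_top]
    refine setLIntegral_congr_fun measurableSet_Ioi fun r hr => ?_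
    have hr' : (0 : ℝ) < r := hr
    have hb (a : Fin N → F) : Measurable fun W => borderedGram r a W :=
      (continuous_borderedGram.comp (by fun_prop : Continuous fun W => ((r, a), W))).measurable
    have hinner (a : Fin N → F) :
        ∫⁻ W, ENNReal.ofReal (D (N + 1) (borderedGram r a W) ^ p) * g (borderedGram r a W)
          ∂(gramMeasure F N N) = ENNReal.ofReal ((r ^ 2) ^ p) *
        ∫⁻ W, ENNReal.ofReal (D N W ^ p) * g (borderedGram r a W) ∂(gramMeasure F N N) := by
      rw [← lintegral_const_mul' _ _ ENNReal.ofReal_ne_top,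
        lintegral_gramMeasure (g := fun W => ENNReal.ofReal (D (N + 1) (borderedGram r a W) ^ p) *
          g (borderedGram r a W)) (((hm _).comp (hb a)).mul (hg.comp (hb a))),
        lintegral_gramMeasure (g := fun W => ENNReal.ofReal ((r ^ 2) ^ p) *
          (ENNReal.ofReal (D N W ^ p) * g (borderedGram r a W)))
          (((hm _).mul (hg.comp (hb a))).const_mul _)]
      refine lintegral_congr fun M => ?_
      rw [hD.bordered, Real.mul_rpow (by positivity) (hD.nonneg N M),
        ENNReal.ofReal_mul (by positivity), mul_assoc]
    -- The factor r² of the bordered determinant contributes r^{β(n-N)}, which turns the radial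
    -- weight of the square case into that of the rectangular one.
    have hpow : r ^ (Module.finrank ℝ F * (N + 1) - 1) * (r ^ 2) ^ p = r ^ (Module.finrank ℝ F * (n + 1) - 1) := by
      have h1 : 1 ≤ Module.finrank ℝ F * (N + 1) := Nat.mul_pos hF (Nat.succ_pos _)
      have h2 : 1 ≤ Module.finrank ℝ F * (n + 1) := Nat.mul_pos hF (Nat.succ_pos _)
      rw [← Real.rpow_natCast r (Module.finrank ℝ F * (n + 1) - 1), ← Real.rpow_natCast r (Module.finrank ℝ F * (N + 1) - 1),
        ← Real.rpow_natCast r 2, ← Real.rpow_mul hr'.le, ← Real.rpow_add hr', Nat.cast_sub h1,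
        Nat.cast_sub h2, hp]
      congr 1
      push_cast
      ring
    have hwd (a : Fin N → F) : ∫⁻ W, g (borderedGram r a W)
          ∂((gramMeasure F N N).withDensity fun W => ENNReal.ofReal (D N W ^ p)) =
        ∫⁻ W, ENNReal.ofReal (D N W ^ p) * g (borderedGram r a W) ∂(gramMeasure F N N) :=
      lintegral_withDensity_eq_lintegral_mul (gramMeasure F N N) (hm N) (hg.comp (hb a))
    simp only [Pi.mul_apply, hinner, lintegral_smul_measure, smul_eq_mul, hwd]
    rw [lintegral_const_mul' _ _ ENNReal.ofReal_ne_top, lintegral_const_mul' _ _ ENNReal.ofReal_ne_top,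
      ← hpow, ENNReal.ofReal_mul (by positivity)]
    ring

end General

/-! ### Absolute continuity of the square Gram distribution. -/

theorem spectrum_finite_of_finiteDimensional {A : Type*} [Ring A] [Algebra ℝ A]
    [FiniteDimensional ℝ A] (a : A) : (spectrum ℝ a).Finite := by
  cases subsingleton_or_nontrivial A
  · rw [spectrum.of_subsingleton]
    exact Set.finite_empty
  have hne : minpoly ℝ a ≠ 0 := minpoly.ne_zero (Algebra.IsIntegral.isIntegral a)
  refine (Polynomial.finite_setOfPred_isRoot hne).subset fun k hk => ?_
  have h := spectrum.subset_polynomial_aeval a (minpoly ℝ a) ⟨k, hk, rfl⟩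
  rw [minpoly.aeval, spectrum.zero_eq] at h
  exact h

theorem LinearMap.measure_preimage_eq_zero {E : Type*} [NormedAddCommGroup E]
    [NormedSpace ℝ E] [FiniteDimensional ℝ E] [MeasurableSpace E] [BorelSpace E] (μ : Measure E)
    [μ.IsAddHaarMeasure] (L : E →ₗ[ℝ] E) (hL : Function.Injective L) {s : Set E} (hs : μ s = 0) :
    μ (L ⁻¹' s) = 0 := by
  have hdet : LinearMap.det L ≠ 0 := (LinearEquiv.ofInjectiveEndo L hL).isUnit_det'.ne_zero
  rw [Measure.addHaar_preimage_linearMap μ hdet, hs, mul_zero]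

theorem ContinuousLinearMap.hasStrictFDerivAt_diag {E : Type*} [NormedAddCommGroup E]
    [NormedSpace ℝ E] (B : E →L[ℝ] E →L[ℝ] E) (c : E) :
    HasStrictFDerivAt (fun x => B x x) (B c + B.flip c) c := by
  have h := HasStrictFDerivAt.comp (f := fun x => (x, x)) c
    (B.isBoundedBilinearMap.hasStrictFDerivAt (c, c))
    ((hasStrictFDerivAt_id c).prodMk (hasStrictFDerivAt_id c))
  convert h using 1
  ext x
  simp

section General
set_option linter.unusedSectionVars false

variable {F : Type} [NormedDivisionRing F] [NormedAlgebra ℝ F] [StarRing F] [StarModule ℝ F]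
  [MeasureSpace F] [BorelSpace F] [FiniteDimensional ℝ F] [(volume : Measure F).IsAddHaarMeasure]
  [StarDivisionAlgebra F] {n N : ℕ}
open StarDivisionAlgebra

theorem isOpen_isUnit_matrix : IsOpen {g : Matrix (Fin N) (Fin N) F | IsUnit g} := by
  have : CompleteSpace F := FiniteDimensional.complete ℝ F
  let _ : NormedRing (Matrix (Fin N) (Fin N) F) := Matrix.linftyOpNormedRing
  let _ : NormedAlgebra ℝ (Matrix (Fin N) (Fin N) F) := Matrix.linftyOpNormedAlgebra
  have : CompleteSpace (Matrix (Fin N) (Fin N) F) := FiniteDimensional.complete ℝ _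
  exact Units.isOpen

/-- For fixed g, the matrix g + t is singular only for the finitely many real t in the spectrum of
-g. By Fubini some t makes g + t invertible for almost every g, and translation invariance removes
t. No determinant over `F` is used. -/
theorem ae_isUnit_matrix : ∀ᵐ g ∂(matrixLebesgue F N N), IsUnit g := by
  have hc : Continuous fun p : ℝ × Matrix (Fin N) (Fin N) F => p.2 + algebraMap ℝ _ p.1 := by
    simp only [Algebra.algebraMap_eq_smul_one]
    fun_prop
  have h1 : ∀ᵐ g ∂(matrixLebesgue F N N), ∀ᵐ t : ℝ, IsUnit (g + algebraMap ℝ _ t) := by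
    refine Filter.Eventually.of_forall fun g => ?_
    refine measure_mono_null (fun t ht => ?_)
      ((spectrum_finite_of_finiteDimensional (-g)).measure_zero volume)
    rw [spectrum.mem_iff, sub_neg_eq_add, add_comm]
    exact ht
  rw [← Measure.ae_ae_comm (μ := (volume : Measure ℝ))
    (p := fun t g => IsUnit (g + algebraMap ℝ (Matrix (Fin N) (Fin N) F) t))
    (isOpen_isUnit_matrix.preimage hc).measurableSet] at h1
  obtain ⟨t, ht⟩ := h1.exists
  have h2 := measure_preimage_add_right (matrixLebesgue F N N)
    (algebraMap ℝ (Matrix (Fin N) (Fin N) F) t) {g | ¬ IsUnit g}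
  exact h2.symm.trans ht

variable (F N) in
/-- The coordinates of a Hermitian matrix. -/
abbrev HermitianCoords : Type := (Fin N → ℝ) × ({p : Fin N × Fin N // p.1 < p.2} → F)

variable (F N) in
/-- `hermitianOfCoords` as a linear map. -/
noncomputable def hermitianOfCoordsLinear : HermitianCoords F N →ₗ[ℝ] Matrix (Fin N) (Fin N) F where
  toFun := hermitianOfCoords
  map_add' c d := by
    ext i j
    simp only [hermitianOfCoords, Matrix.of_apply, Matrix.add_apply]
    split_ifs <;> simp
  map_smul' r c := by
    ext i j
    simp only [hermitianOfCoords, Matrix.of_apply, Matrix.smul_apply]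
    split_ifs
    · simp
    · simp [star_smul]
    · simp [Algebra.smul_def]

variable (F N) in
/-- The coordinates of the Hermitian part of a matrix. -/
noncomputable def coordsOfMatrix : Matrix (Fin N) (Fin N) F →ₗ[ℝ] HermitianCoords F N where
  toFun W := (fun i => re (W i i), fun p => W p.1.1 p.1.2)
  map_add' _ _ := by ext <;> simp
  map_smul' _ _ := by ext <;> simp

theorem coordsOfMatrix_hermitianOfCoords (c : HermitianCoords F N) :
    coordsOfMatrix F N (hermitianOfCoords c) = c := by
  ext p
  · simp [coordsOfMatrix, hermitianOfCoords, re_algebraMap]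
  · simp [coordsOfMatrix, hermitianOfCoords, p.2]

theorem hermitianOfCoords_isHermitian (c : HermitianCoords F N) :
    (hermitianOfCoords c).IsHermitian := by
  ext i j
  rw [Matrix.conjTranspose_apply]
  rcases lt_trichotomy i j with h | rfl | h
  · simp [hermitianOfCoords, h, h.not_gt]
  · simp [hermitianOfCoords, star_algebraMap_real]
  · simp [hermitianOfCoords, h, h.not_gt]

theorem hermitianOfCoords_coordsOfMatrix {W : Matrix (Fin N) (Fin N) F} (hW : W.IsHermitian) :
    hermitianOfCoords (coordsOfMatrix F N W) = W := by
  ext i j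
  rcases lt_trichotomy i j with h | rfl | h
  · simp [hermitianOfCoords, coordsOfMatrix, h]
  · simp [hermitianOfCoords, coordsOfMatrix, algebraMap_re_of_star_eq _ (hW.apply i i)]
  · simp [hermitianOfCoords, coordsOfMatrix, h, h.not_gt, hW.apply i j]

theorem continuous_hermitianOfCoords : Continuous (hermitianOfCoords (F := F) (N := N)) :=
  LinearMap.continuous_of_finiteDimensional (hermitianOfCoordsLinear F N)

theorem continuous_coordsOfMatrix : Continuous (coordsOfMatrix F N) :=
  LinearMap.continuous_of_finiteDimensional
    (show (Fin N → Fin N → F) →ₗ[ℝ] HermitianCoords F N from coordsOfMatrix F N)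

theorem gram_mem_posHermitian (M : Matrix (Fin n) (Fin N) F) : Mᴴ * M ∈ posHermitian F N := by
  refine ⟨Matrix.isHermitian_conjTranspose_mul_self M, fun a v hv h => ?_⟩
  have h1 : star v ⬝ᵥ ((Mᴴ * M) *ᵥ v) = star (M *ᵥ v) ⬝ᵥ (M *ᵥ v) := by
    rw [Matrix.star_mulVec, Matrix.dotProduct_mulVec, Matrix.dotProduct_mulVec,
      Matrix.vecMul_vecMul]
  rw [h, dotProduct_smul, star_dotProduct_self_eq, star_dotProduct_self_eq, Algebra.smul_def,
    ← map_mul] at h1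
  have h2 := (algebraMap ℝ F).injective h1
  have h3 : 0 < ∑ i, ‖v i‖ ^ 2 := by
    obtain ⟨i, hi⟩ := Function.ne_iff.1 hv
    refine Finset.sum_pos' (fun _ _ => by positivity) ⟨i, Finset.mem_univ i, ?_⟩
    have : 0 < ‖v i‖ := norm_pos_iff.2 hi
    positivity
  have h4 : 0 ≤ ∑ i, ‖(M *ᵥ v) i‖ ^ 2 := Finset.sum_nonneg fun _ _ => by positivity
  rw [← h2] at h4
  exact nonneg_of_mul_nonneg_left h4 h3

instance : (volume : Measure (HermitianCoords F N)).IsAddHaarMeasure :=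
  have : (volume : Measure ({p : Fin N × Fin N // p.1 < p.2} → F)).IsAddHaarMeasure :=
    pi_const_isAddHaarMeasure F volume _
  Measure.prod.instIsAddHaarMeasure volume volume

/-- Congruence by an invertible matrix preserves null sets of Hermitian matrices. -/
theorem measure_congruence_preimage_eq_zero {g : Matrix (Fin N) (Fin N) F} (hg : IsUnit g)
    {Z : Set (HermitianCoords F N)} (hZ : volume Z = 0) :
    volume {c | coordsOfMatrix F N (gᴴ * hermitianOfCoords c * g) ∈ Z} = 0 := by
  let L : HermitianCoords F N →ₗ[ℝ] HermitianCoords F N :=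
    { toFun := fun c => coordsOfMatrix F N (gᴴ * hermitianOfCoordsLinear F N c * g)
      map_add' := fun c d => by simp only [map_add, Matrix.mul_add, Matrix.add_mul]
      map_smul' := fun r c => by simp only [map_smul, Matrix.mul_smul, Matrix.smul_mul,
        RingHom.id_apply] }
  refine LinearMap.measure_preimage_eq_zero volume L (fun c d h => ?_) hZ
  have hH (c : HermitianCoords F N) : (gᴴ * hermitianOfCoords c * g).IsHermitian :=
    Matrix.isHermitian_conjTranspose_mul_mul g (hermitianOfCoords_isHermitian c)
  have h' := congrArg hermitianOfCoords h
  change hermitianOfCoords (coordsOfMatrix F N (gᴴ * hermitianOfCoords c * g)) =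
    hermitianOfCoords (coordsOfMatrix F N (gᴴ * hermitianOfCoords d * g)) at h'
  rw [hermitianOfCoords_coordsOfMatrix (hH c), hermitianOfCoords_coordsOfMatrix (hH d)] at h'
  have hg' : IsUnit gᴴ := hg.star
  have h2 := hg'.mul_left_cancel (hg.mul_right_cancel h')
  rw [← coordsOfMatrix_hermitianOfCoords c, h2, coordsOfMatrix_hermitianOfCoords]

/-- The coordinates of Gram matrices of invertible matrices form a neighbourhood of those of `1`. -/
theorem setOf_gram_isUnit_mem_nhds :
    {c : HermitianCoords F N | ∃ h : Matrix (Fin N) (Fin N) F, IsUnit h ∧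
      hermitianOfCoords c = hᴴ * h} ∈ nhds (coordsOfMatrix F N 1) := by
  have : CompleteSpace F := FiniteDimensional.complete ℝ F
  let B : HermitianCoords F N →L[ℝ] HermitianCoords F N →L[ℝ] HermitianCoords F N :=
    LinearMap.toContinuousBilinearMap <| LinearMap.mk₂ ℝ
      (fun c d => coordsOfMatrix F N (hermitianOfCoordsLinear F N c * hermitianOfCoordsLinear F N d))
      (fun c d e => by simp only [map_add, add_mul])
      (fun r c d => by simp only [map_smul, smul_mul_assoc])
      (fun c d e => by simp only [map_add, mul_add])
      (fun r c d => by simp only [map_smul, mul_smul_comm])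
  have hB (c d : HermitianCoords F N) :
    B c d = coordsOfMatrix F N (hermitianOfCoords c * hermitianOfCoords d) := rfl
  set c₀ := coordsOfMatrix F N 1 with hc₀
  have hone : hermitianOfCoords c₀ = (1 : Matrix (Fin N) (Fin N) F) :=
    hermitianOfCoords_coordsOfMatrix Matrix.isHermitian_one
  have hder : HasStrictFDerivAt (fun c => B c c) (B c₀ + B.flip c₀) c₀ :=
    B.hasStrictFDerivAt_diag c₀
  have hsurj : (B c₀ + B.flip c₀).range = ⊤ := by
    -- Squaring Hermitian matrices has derivative d ↦ 2d at the identity, whence the preimage d/2.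
    -- Surjectivity makes the squares fill a neighbourhood of 1.
    refine LinearMap.range_eq_top.2 fun d => ⟨(1 / 2 : ℝ) • d, ?_⟩
    have h1 : B c₀ d = d := by
      rw [hB, hone, one_mul, coordsOfMatrix_hermitianOfCoords]
    have h2 : B d c₀ = d := by
      rw [hB, hone, mul_one, coordsOfMatrix_hermitianOfCoords]
    simp only [map_smul]
    change (1 / 2 : ℝ) • (B c₀ d + B d c₀) = d
    rw [h1, h2, ← two_smul ℝ d, smul_smul]
    norm_num
  have hmap := hder.map_nhds_eq_of_surj hsurj
  have hval : B c₀ c₀ = c₀ := by rw [hB, hone, one_mul]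
  rw [hval] at hmap
  rw [← hmap]
  have hU : {c : HermitianCoords F N | IsUnit (hermitianOfCoords c)} ∈ nhds c₀ :=
    (isOpen_isUnit_matrix.preimage continuous_hermitianOfCoords).mem_nhds
      (show IsUnit (hermitianOfCoords c₀) from hone ▸ isUnit_one)
  refine Filter.mem_map.2 (Filter.mem_of_superset hU fun c hc => ⟨hermitianOfCoords c, hc, ?_⟩)
  have hH := hermitianOfCoords_isHermitian c
  have hgram := Matrix.isHermitian_conjTranspose_mul_self (hermitianOfCoords c)
  rw [hH.eq] at hgram ⊢
  exact hermitianOfCoords_coordsOfMatrix hgram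

theorem measure_mul_left_preimage_eq_zero {h : Matrix (Fin N) (Fin N) F} (hu : IsUnit h)
    {s : Set (Matrix (Fin N) (Fin N) F)} (hs : matrixLebesgue F N N s = 0) :
    matrixLebesgue F N N {M | h * M ∈ s} = 0 := by
  let L : (Fin N → Fin N → F) →ₗ[ℝ] (Fin N → Fin N → F) :=
    { toFun := fun M => h * Matrix.of M
      map_add' := fun A B => Matrix.mul_add _ (Matrix.of A) (Matrix.of B)
      map_smul' := fun c M => Matrix.mul_smul _ c (Matrix.of M) }
  have := pi_const_isAddHaarMeasure (Fin N → F) (Measure.pi fun _ => (volume : Measure F)) (Fin N)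
  have hL : Function.Injective L := fun A B hAB =>
    hu.mul_left_cancel (show h * Matrix.of A = h * Matrix.of B from hAB)
  exact LinearMap.measure_preimage_eq_zero
    (Measure.pi fun _ : Fin N => Measure.pi fun _ : Fin N => (volume : Measure F)) L hL hs

/-- For a null set Z and invertible g, the congruence by g pulls Z back to a null set. Exchanging
the quantifiers by Fubini, for almost every Hermitian c the matrix g†cg avoids Z for almost every g.
Some such c has the form h†h with h invertible, and then g†cg = (hg)†(hg), where M = hg is an
invertible linear change of variable. -/
theorem gramMeasure_absolutelyContinuous : gramMeasure F N N ≪ posHermitianLebesgue F N := by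
  refine Measure.AbsolutelyContinuous.mk fun E hE hE0 => ?_
  rw [posHermitianLebesgue, Measure.restrict_apply hE] at hE0
  have hZ0 : volume (hermitianOfCoords (F := F) (N := N) ⁻¹' (E ∩ posHermitian F N)) = 0 :=
    le_antisymm ((Measure.le_map_apply continuous_hermitianOfCoords.measurable.aemeasurable _).trans
      hE0.le) zero_le
  -- Fubini needs a measurable set, and the cone is not shown to be measurable; hence the measurable
  -- hull.
  set Z := toMeasurable volume (hermitianOfCoords (F := F) (N := N) ⁻¹' (E ∩ posHermitian F N))
    with hZ
  have hZm : MeasurableSet Z := measurableSet_toMeasurable _ _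
  have hZn : volume Z = 0 := (measure_toMeasurable _).trans hZ0
  have hcont : Continuous fun p : Matrix (Fin N) (Fin N) F × HermitianCoords F N =>
      coordsOfMatrix F N (p.1ᴴ * hermitianOfCoords p.2 * p.1) := by
    have h1 := continuous_coordsOfMatrix (F := F) (N := N)
    have h2 := continuous_hermitianOfCoords (F := F) (N := N)
    fun_prop
  have hae : ∀ᵐ g ∂(matrixLebesgue F N N), ∀ᵐ c : HermitianCoords F N,
      coordsOfMatrix F N (gᴴ * hermitianOfCoords c * g) ∉ Z := by
    filter_upwards [ae_isUnit_matrix] with g hg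
    have := measure_congruence_preimage_eq_zero hg hZn
    rw [ae_iff]
    simpa using this
  rw [Measure.ae_ae_comm (p := fun g c => coordsOfMatrix F N (gᴴ * hermitianOfCoords c * g) ∉ Z) (hcont.measurable hZm.compl)] at hae
  obtain ⟨c, hc, h, hu, hch⟩ : ∃ c : HermitianCoords F N,
      (∀ᵐ g ∂(matrixLebesgue F N N), coordsOfMatrix F N (gᴴ * hermitianOfCoords c * g) ∉ Z) ∧
      ∃ h : Matrix (Fin N) (Fin N) F, IsUnit h ∧ hermitianOfCoords c = hᴴ * h := by
    -- The admissible c contain a neighbourhood of the identity, which has positive measure and so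
    -- cannot lie inside the exceptional null set.
    by_contra! hcon
    refine (Measure.measure_pos_of_mem_nhds volume (setOf_gram_isUnit_mem_nhds (F := F) (N := N))).ne'
      (measure_mono_null ?_ hae)
    rintro c ⟨h, hu, hch⟩ hc
    exact hcon c hc h hu hch
  obtain ⟨w, hhw, hwh⟩ := isUnit_iff_exists.1 hu
  have hw : IsUnit w := isUnit_iff_exists.2 ⟨h, hwh, hhw⟩
  have hnull := measure_mul_left_preimage_eq_zero hw (ae_iff.1 hc)
  rw [gramMeasure, Measure.map_apply continuous_gram.measurable hE]
  refine measure_mono_null (fun M hM => ?_) hnull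
  have hM' : (w * M)ᴴ * (hᴴ * h) * (w * M) = Mᴴ * M := by
    have h1 : h * (w * M) = M := by rw [← mul_assoc, hhw, one_mul]
    have h2 : (w * M)ᴴ * hᴴ = Mᴴ := by rw [← Matrix.conjTranspose_mul, h1]
    rw [← mul_assoc (w * M)ᴴ, h2, mul_assoc, h1]
  rw [Set.mem_ofPred_eq, Set.mem_ofPred_eq, hch, hM', not_not]
  refine subset_toMeasurable _ _ ?_
  rw [Set.mem_preimage, hermitianOfCoords_coordsOfMatrix (gram_mem_posHermitian M).1]
  exact ⟨hM, gram_mem_posHermitian M⟩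

end General

/-! ### From the identity of measures to integrals of real functions. -/

section General

variable {F : Type} [NormedDivisionRing F] [NormedAlgebra ℝ F] [StarRing F] [StarModule ℝ F]
  [MeasureSpace F] [BorelSpace F] [FiniteDimensional ℝ F] [(volume : Measure F).IsAddHaarMeasure]
  [StarDivisionAlgebra F] {n N : ℕ}

/-- Both claims are transported to the Gram distributions. The measurability of f passes from (dW)
to G(N,N) by absolute continuity, and from there to G(n,N) by the density formula. The equality
needs no integrability, because otherwise both Bochner integrals are 0. -/
theorem integrable_gram_iff_and_integral_gram_eq {D : ∀ N : ℕ, Matrix (Fin N) (Fin N) F → ℝ}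
    (hD : IsGramDet D) (hN : N ≤ n) {f : Matrix (Fin N) (Fin N) F → ℝ}
    (hf : AEMeasurable f (posHermitianLebesgue F N)) :
    (Integrable (fun M : Matrix (Fin n) (Fin N) F => f (Mᴴ * M)) (matrixLebesgue F n N) ↔
      Integrable (fun M : Matrix (Fin N) (Fin N) F =>
        f (Mᴴ * M) * D N (Mᴴ * M) ^ ((Module.finrank ℝ F : ℝ) * ((n : ℝ) - N) / 2))
        (matrixLebesgue F N N)) ∧
    ∫ M : Matrix (Fin n) (Fin N) F, f (Mᴴ * M) ∂(matrixLebesgue F n N) =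
      polarConst (Module.finrank ℝ F) n N * ∫ M : Matrix (Fin N) (Fin N) F,
        f (Mᴴ * M) * D N (Mᴴ * M) ^ ((Module.finrank ℝ F : ℝ) * ((n : ℝ) - N) / 2)
          ∂(matrixLebesgue F N N) := by
  have hF : 0 < Module.finrank ℝ F := Module.finrank_pos
  have hc := polarConst_pos hF hN
  have heq := gramMeasure_eq_smul_withDensity hF hD hN
  set p : ℝ := (Module.finrank ℝ F : ℝ) * ((n : ℝ) - N) / 2
  have hm : Measurable fun W => ENNReal.ofReal (D N W ^ p) := by
    have := hD.measurable N
    fun_prop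
  have hfN : AEStronglyMeasurable f (gramMeasure F N N) :=
    (hf.mono_ac gramMeasure_absolutelyContinuous).aestronglyMeasurable
  have hfn : AEStronglyMeasurable f (gramMeasure F n N) := by
    rw [heq]
    exact (hfN.mono_ac (withDensity_absolutelyContinuous _ _)).smul_measure _
  have hfD : AEStronglyMeasurable (fun W => f W * (ENNReal.ofReal (D N W ^ p)).toReal)
      (gramMeasure F N N) := hfN.mul hm.ennreal_toReal.aestronglyMeasurable
  have hgram (m : ℕ) : AEMeasurable (fun M : Matrix (Fin m) (Fin N) F => Mᴴ * M)
      (matrixLebesgue F m N) := continuous_gram.measurable.aemeasurable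
  have hpt (M : Matrix (Fin N) (Fin N) F) :
      (ENNReal.ofReal (D N (Mᴴ * M) ^ p)).toReal = D N (Mᴴ * M) ^ p :=
    ENNReal.toReal_ofReal (Real.rpow_nonneg (hD.nonneg N M) p)
  constructor
  · have h1 := integrable_map_measure hfn (hgram n)
    have h2 := integrable_map_measure hfD (hgram N)
    simp only [Function.comp_def, hpt] at h1 h2
    rw [← h1, ← h2]
    change Integrable f (gramMeasure F n N) ↔ Integrable _ (gramMeasure F N N)
    rw [heq, integrable_smul_measure (ENNReal.ofReal_pos.2 hc).ne' ENNReal.ofReal_ne_top,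
      integrable_withDensity_iff hm (Filter.Eventually.of_forall fun _ => ENNReal.ofReal_lt_top)]
  · have h1 := integral_map (hgram n) hfn
    have h2 := integral_map (hgram N) hfD
    simp only [hpt] at h2
    rw [← h1, ← h2]
    change ∫ W, f W ∂(gramMeasure F n N) = _ * ∫ W, _ ∂(gramMeasure F N N)
    rw [heq, integral_smul_measure, ENNReal.toReal_ofReal hc.le,
      integral_withDensity_eq_integral_toReal_smul hm
        (Filter.Eventually.of_forall fun _ => ENNReal.ofReal_lt_top), smul_eq_mul]
    simp only [smul_eq_mul, mul_comm]

end General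

/-! ### The real, complex and quaternion instances and their determinants. -/

theorem lintegral_ofReal_eq_of_integral_eq {α : Type*} [MeasurableSpace α] {μ : Measure α}
    {f : α → ℝ} (hf : ∀ x, 0 ≤ f x) {c : ℝ} (hc : 0 < c) (h : ∫ x, f x ∂μ = c) :
    ∫⁻ x, ENNReal.ofReal (f x) ∂μ = ENNReal.ofReal c := by
  have hi : Integrable f μ := not_imp_comm.1 integral_undef (h ▸ hc.ne')
  rw [← h, ofReal_integral_eq_lintegral_ofReal hi (Filter.Eventually.of_forall hf)]

noncomputable instance : StarDivisionAlgebra ℝ where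
  re := LinearMap.id
  re_algebraMap _ := rfl
  algebraMap_re_of_star_eq _ _ := rfl
  star_mul_self_eq x := by simp [sq]
  lintegral_gaussian := by
    refine lintegral_ofReal_eq_of_integral_eq (fun _ => (Real.exp_pos _).le)
      (Real.rpow_pos_of_pos Real.pi_pos _) ?_
    have h := integral_gaussian 1
    simpa [Real.sqrt_eq_rpow] using h

noncomputable instance : StarDivisionAlgebra ℂ where
  re := Complex.reLm
  re_algebraMap _ := by simp
  algebraMap_re_of_star_eq x h := Complex.conj_eq_iff_re.1 h
  star_mul_self_eq x := by
    simpa using Complex.conj_mul' x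
  lintegral_gaussian := by
    refine lintegral_ofReal_eq_of_integral_eq (fun _ => (Real.exp_pos _).le)
      (Real.rpow_pos_of_pos Real.pi_pos _) ?_
    have h := Complex.integral_exp_neg_rpow (p := 2) one_le_two
    have h2 : Real.Gamma (1 + 1) = 1 := by simpa using Real.Gamma_nat_eq_factorial 1
    simpa [h2] using h

instance : StarModule ℝ ℍ[ℝ] where
  star_smul r q := by rw [Quaternion.star_smul, star_trivial r]

noncomputable instance : StarDivisionAlgebra ℍ[ℝ] where
  re := { toFun := fun x => x.re, map_add' := fun _ _ => rfl, map_smul' := fun _ _ => rfl }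
  re_algebraMap _ := rfl
  algebraMap_re_of_star_eq x h := (Quaternion.star_eq_self.1 h).symm
  star_mul_self_eq x := by
    rw [Quaternion.star_mul_self, Quaternion.normSq_eq_norm_mul_self, sq]
    rfl
  lintegral_gaussian := by
    refine lintegral_ofReal_eq_of_integral_eq (fun _ => (Real.exp_pos _).le)
      (Real.rpow_pos_of_pos Real.pi_pos _) ?_
    have h := GaussianFourier.integral_rexp_neg_mul_sq_norm (V := ℍ[ℝ]) one_pos
    simpa using h

theorem det_consCol_single {R : Type} [CommRing R] {N : ℕ} (x : R) (a : Fin N → R)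
    (M : Matrix (Fin N) (Fin N) R) :
    (Matrix.consCol (Pi.single 0 x) (Matrix.consRow a M)).det = x * M.det := by
  rw [Matrix.det_succ_column_zero, Fin.sum_univ_succ, Finset.sum_eq_zero]
  · have : (Matrix.consCol (Pi.single 0 x) (Matrix.consRow a M)).submatrix (Fin.succAbove 0)
        Fin.succ = M := by
      ext i j
      simp [Matrix.consCol]
    rw [this]
    simp [Matrix.consCol]
  · intro i _
    simp [Matrix.consCol]

theorem isGramDet_real : IsGramDet (F := ℝ) fun _ W => W.det where
  measurable N := (by fun_prop : Continuous fun W : Matrix (Fin N) (Fin N) ℝ => W.det).measurable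
  eq_one W := Matrix.det_isEmpty
  nonneg N M := by
    rw [Matrix.det_mul, Matrix.det_conjTranspose]
    exact star_mul_self_nonneg _
  bordered N r a M := by
    rw [← gram_consCol_single, Matrix.det_mul, Matrix.det_conjTranspose, det_consCol_single,
      Matrix.det_mul, Matrix.det_conjTranspose]
    simp
    ring

theorem isGramDet_complex : IsGramDet (F := ℂ) fun _ W => W.det.re where
  measurable N :=
    (by fun_prop : Continuous fun W : Matrix (Fin N) (Fin N) ℂ => W.det.re).measurable
  eq_one W := by simp
  nonneg N M := by
    rw [Matrix.det_mul, Matrix.det_conjTranspose]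
    have := Complex.normSq_nonneg M.det
    rw [Complex.star_def, ← Complex.normSq_eq_conj_mul_self]
    simpa using this
  bordered N r a M := by
    rw [← gram_consCol_single, Matrix.det_mul, Matrix.det_conjTranspose, det_consCol_single,
      Matrix.det_mul, Matrix.det_conjTranspose, Complex.star_def,
      ← Complex.normSq_eq_conj_mul_self, ← Complex.normSq_eq_conj_mul_self]
    simp [Complex.normSq_mul, sq]

theorem quaternionBlock_mul (p q : ℍ[ℝ]) :
    quaternionBlock (p * q) = quaternionBlock p * quaternionBlock q := by
  ext i j
  fin_cases i <;> fin_cases j <;>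
    simp [quaternionBlock, Matrix.mul_apply, Fin.sum_univ_two, Complex.ext_iff] <;>
    constructor <;> ring

theorem quaternionBlock_star (q : ℍ[ℝ]) : quaternionBlock (star q) = (quaternionBlock q)ᴴ := by
  ext i j
  fin_cases i <;> fin_cases j <;> simp [quaternionBlock, Complex.ext_iff]

/-- `quaternionBlock` as an additive homomorphism. -/
def quaternionBlockHom : ℍ[ℝ] →+ Matrix (Fin 2) (Fin 2) ℂ where
  toFun := quaternionBlock
  map_zero' := by
    ext i j
    fin_cases i <;> fin_cases j <;> simp [quaternionBlock, Complex.ext_iff]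
  map_add' p q := by
    ext i j
    fin_cases i <;> fin_cases j <;> simp [quaternionBlock, Complex.ext_iff, add_comm]

theorem quaternionToComplex_mul {N : ℕ} (A B : Matrix (Fin N) (Fin N) ℍ[ℝ]) :
    quaternionToComplex (A * B) = quaternionToComplex A * quaternionToComplex B := by
  ext ⟨i, k⟩ ⟨j, l⟩
  have h : quaternionBlock ((A * B) i j) =
      ∑ x, quaternionBlock (A i x) * quaternionBlock (B x j) := by
    rw [Matrix.mul_apply]
    exact (map_sum quaternionBlockHom _ _).trans
      (Finset.sum_congr rfl fun x _ => quaternionBlock_mul _ _)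
  rw [Matrix.mul_apply, Fintype.sum_prod_type]
  change quaternionBlock ((A * B) i j) k l = _
  rw [h, Matrix.sum_apply]
  rfl

theorem quaternionToComplex_conjTranspose {N : ℕ} (A : Matrix (Fin N) (Fin N) ℍ[ℝ]) :
    quaternionToComplex Aᴴ = (quaternionToComplex A)ᴴ := by
  ext ⟨i, k⟩ ⟨j, l⟩
  simp [quaternionToComplex, quaternionBlock_star]

/-- The complex representation is a *-homomorphism, so the determinant under the square root is |det
A|² for the complex form of A. -/
theorem quaternionDet_gram {N : ℕ} (A : Matrix (Fin N) (Fin N) ℍ[ℝ]) :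
    quaternionDet (Aᴴ * A) = ‖(quaternionToComplex A).det‖ := by
  rw [quaternionDet, quaternionToComplex_mul, quaternionToComplex_conjTranspose, Matrix.det_mul,
    Matrix.det_conjTranspose, Complex.star_def, Complex.conj_mul']
  norm_cast
  exact Real.sqrt_sq (norm_nonneg _)

theorem det_quaternionToComplex_consCol_single {N : ℕ} (r : ℝ) (a : Fin N → ℍ[ℝ])
    (M : Matrix (Fin N) (Fin N) ℍ[ℝ]) :
    (quaternionToComplex (Matrix.consCol (Pi.single 0 (algebraMap ℝ ℍ[ℝ] r))
      (Matrix.consRow a M))).det = (r : ℂ) ^ 2 * (quaternionToComplex M).det := by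
  -- The reindexing separates the two complex indices of the first quaternion coordinate, making the
  -- matrix block upper triangular. The 2 × 2 block of the real number r has determinant r².
  let e : Fin 2 ⊕ Fin N × Fin 2 ≃ Fin (N + 1) × Fin 2 :=
    { toFun := Sum.elim (fun k => (0, k)) fun p => (p.1.succ, p.2)
      invFun := fun p => Fin.cases (motive := fun _ => Fin 2 ⊕ Fin N × Fin 2) (Sum.inl p.2)
        (fun i => Sum.inr (i, p.2)) p.1
      left_inv := by rintro (k | ⟨i, k⟩) <;> rfl
      right_inv := by
        rintro ⟨i, k⟩
        refine Fin.cases ?_ (fun i => ?_) i <;> rfl }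
  set A := quaternionToComplex (Matrix.consCol (Pi.single 0 (algebraMap ℝ ℍ[ℝ] r))
      (Matrix.consRow a M)) with hA
  have hblock : A.submatrix e e = Matrix.fromBlocks (quaternionBlock (algebraMap ℝ ℍ[ℝ] r))
      (A.submatrix (e ∘ Sum.inl) (e ∘ Sum.inr)) 0 (quaternionToComplex M) := by
    ext x y
    rcases x with k | ⟨i, k⟩ <;> rcases y with l | ⟨j, l⟩
    · simp [hA, e, quaternionToComplex, Matrix.consCol]
    · rfl
    · have h0 : quaternionBlock 0 = 0 := quaternionBlockHom.map_zero
      simp [hA, e, quaternionToComplex, Matrix.consCol, h0]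
    · simp [hA, e, quaternionToComplex, Matrix.consCol]
  rw [← Matrix.det_submatrix_equiv_self e A, hblock, Matrix.det_fromBlocks_zero₂₁]
  congr 1
  simp [quaternionBlock, Matrix.det_fin_two, Complex.ext_iff, sq]

theorem continuous_quaternionDet {N : ℕ} :
    Continuous (quaternionDet : Matrix (Fin N) (Fin N) ℍ[ℝ] → ℝ) := by
  have hb : Continuous quaternionBlock := by
    have h1 : Continuous fun q : ℍ[ℝ] => (⟨q.re, q.imI⟩ : ℂ) :=
      Complex.equivRealProdCLM.symm.continuous.comp
        (Quaternion.continuous_re.prodMk Quaternion.continuous_imI)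
    have h2 : Continuous fun q : ℍ[ℝ] => (⟨q.imJ, q.imK⟩ : ℂ) :=
      Complex.equivRealProdCLM.symm.continuous.comp
        (Quaternion.continuous_imJ.prodMk Quaternion.continuous_imK)
    refine continuous_matrix fun i j => ?_
    fin_cases i <;> fin_cases j
    exacts [h1, h2, h2.star.neg, h1.star]
  have hq : Continuous (quaternionToComplex : Matrix (Fin N) (Fin N) ℍ[ℝ] → _) :=
    continuous_matrix fun p q =>
      (hb.comp (continuous_apply_apply p.1 q.1)).matrix_elem p.2 q.2
  unfold quaternionDet
  fun_prop

theorem isGramDet_quaternion : IsGramDet (F := ℍ[ℝ]) fun _ W => quaternionDet W where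
  measurable N := continuous_quaternionDet.measurable
  eq_one W := by simp [quaternionDet]
  nonneg N M := Real.sqrt_nonneg _
  bordered N r a M := by
    rw [← gram_consCol_single, quaternionDet_gram, quaternionDet_gram,
      det_quaternionToComplex_consCol_single]
    simp

theorem corollaryC3 (n N : ℕ) (hN : N ≤ n) :
    -- the real case, `β = 1`
    (∀ f : Matrix (Fin N) (Fin N) ℝ → ℝ, AEMeasurable f (posHermitianLebesgue ℝ N) →
      (Integrable (fun M : Matrix (Fin n) (Fin N) ℝ => f (Mᴴ * M)) (matrixLebesgue ℝ n N) ↔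
        Integrable (fun M : Matrix (Fin N) (Fin N) ℝ =>
          f (Mᴴ * M) * (Mᴴ * M).det ^ ((1 : ℝ) * ((n : ℝ) - N) / 2)) (matrixLebesgue ℝ N N)) ∧
      ∫ M : Matrix (Fin n) (Fin N) ℝ, f (Mᴴ * M) ∂(matrixLebesgue ℝ n N) =
        polarConst 1 n N * ∫ M : Matrix (Fin N) (Fin N) ℝ,
          f (Mᴴ * M) * (Mᴴ * M).det ^ ((1 : ℝ) * ((n : ℝ) - N) / 2) ∂(matrixLebesgue ℝ N N)) ∧
    -- the complex case, `β = 2`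
    (∀ f : Matrix (Fin N) (Fin N) ℂ → ℝ, AEMeasurable f (posHermitianLebesgue ℂ N) →
      (Integrable (fun M : Matrix (Fin n) (Fin N) ℂ => f (Mᴴ * M)) (matrixLebesgue ℂ n N) ↔
        Integrable (fun M : Matrix (Fin N) (Fin N) ℂ =>
          f (Mᴴ * M) * (Mᴴ * M).det.re ^ ((2 : ℝ) * ((n : ℝ) - N) / 2)) (matrixLebesgue ℂ N N)) ∧
      ∫ M : Matrix (Fin n) (Fin N) ℂ, f (Mᴴ * M) ∂(matrixLebesgue ℂ n N) =
        polarConst 2 n N * ∫ M : Matrix (Fin N) (Fin N) ℂ,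
          f (Mᴴ * M) * (Mᴴ * M).det.re ^ ((2 : ℝ) * ((n : ℝ) - N) / 2) ∂(matrixLebesgue ℂ N N)) ∧
    -- the real quaternion case, `β = 4`
    (∀ f : Matrix (Fin N) (Fin N) ℍ[ℝ] → ℝ, AEMeasurable f (posHermitianLebesgue ℍ[ℝ] N) →
      (Integrable (fun M : Matrix (Fin n) (Fin N) ℍ[ℝ] => f (Mᴴ * M)) (matrixLebesgue ℍ[ℝ] n N) ↔
        Integrable (fun M : Matrix (Fin N) (Fin N) ℍ[ℝ] =>
          f (Mᴴ * M) * quaternionDet (Mᴴ * M) ^ ((4 : ℝ) * ((n : ℝ) - N) / 2))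
          (matrixLebesgue ℍ[ℝ] N N)) ∧
      ∫ M : Matrix (Fin n) (Fin N) ℍ[ℝ], f (Mᴴ * M) ∂(matrixLebesgue ℍ[ℝ] n N) =
        polarConst 4 n N * ∫ M : Matrix (Fin N) (Fin N) ℍ[ℝ],
          f (Mᴴ * M) * quaternionDet (Mᴴ * M) ^ ((4 : ℝ) * ((n : ℝ) - N) / 2)
            ∂(matrixLebesgue ℍ[ℝ] N N)) := by
  refine ⟨fun f hf => ?_, fun f hf => ?_, fun f hf => ?_⟩
  · have h := integrable_gram_iff_and_integral_gram_eq isGramDet_real hN hf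
    rw [Module.finrank_self, Nat.cast_one] at h
    exact h
  · have h := integrable_gram_iff_and_integral_gram_eq isGramDet_complex hN hf
    rw [Complex.finrank_real_complex, Nat.cast_ofNat] at h
    exact h
  · have h := integrable_gram_iff_and_integral_gram_eq isGramDet_quaternion hN hf
    rw [Quaternion.finrank_eq_four, Nat.cast_ofNat] at h
    exact h
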